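/- **Model.** Let $G$ be a finite simple graph with vertex set $V$. A labeling scheme for $G$ with labels of $s$ bits (and two-sided error) consists of a deterministic decoder $\mathcal D\colon\{0,1\}^s\times\{0,1\}^s\to\{0,1\}$ and an encoder, i.e. an arbitrary probability distribution over functions $\ell\colon V\to\{0,1\}^s$; the decoder may err both on edges and on non-edges, and both may depend on $G$. In the game against an adversary (who knows $G$, the encoder's distribution and $\mathcal D$), a labeling $\ell$ is drawn from the encoder, the adversary adaptively queries the labels of vertices $x_1,\dots,x_k$ (with $k\le |V|-2$), and then declares two distinct vertices $x_{k+1},x_{k+2}$ that it has not queried. It forges (wins) if the decoder is wrong on them, i.e. if $\mathcal D(\ell(x_{k+1}),\ell(x_{k+2}))=1$ while $x_{k+1},x_{k+2}$ are not adjacent, or $\mathcal D(\ell(x_{k+1}),\ell(x_{k+2}))=0$ while they are adjacent. **Theorem.** There is an absolute constant $c>0$ such that the following holds. Let $\alpha\in(0,1/2)$. For every $d\in\mathbb N$ there exists $n>0$ (depending only on $\alpha$ and $d$) such that for every finite simple graph $G$ containing $n$ vertices of degree at least $d$ that are pairwise at distance at least $3$ (vertices in different components being at infinite distance), and for every labeling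 scheme for $G$ with two-sided error whose labels have $s< c\,\alpha^4 d$ bits, there is an adversary that forges with probability at least $\frac12-\alpha$. -/

import Mathlib

/-- A randomized adjacency labeling scheme (adjacency sketch) for one given vertex set, with labels
of `s` bits: a deterministic decoder, and an encoder, i.e. a probability distribution over the
functions that label the vertices with `s`-bit strings. Errors on edges and on non-edges are both
allowed, and the labels of different vertices may be correlated arbitrarily. -/
structure LabelingScheme (V : Type*) (s : ℕ) where
  decoder : (Fin s → Bool) → (Fin s → Bool) → Bool
  encoder : PMF (V → (Fin s → Bool))

/-- A deterministic adaptive strategy of an adversary who sees labels from `L`: it either declares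
an ordered pair of candidates, or queries the label of a vertex and continues in a way that may
depend on the answer. -/
inductive Adversary (V : Type*) (L : Type*) where
  | declare (x y : V) : Adversary V L
  | query (x : V) (next : L → Adversary V L) : Adversary V L

namespace Adversary

/-- The strategy respects the rules of the game when the labels of the vertices in `Q` have already
been queried: no vertex is queried twice, and the two candidates that it declares in the end are
distinct vertices that have not been queried. In particular, on a graph with `N` vertices a strategy
that is legal for `Q = ∅` makes at most `N - 2` queries. -/
def Legal {V L : Type*} : Adversary V L → Set V → Prop
  | declare x y, Q => x ≠ y ∧ x ∉ Q ∧ y ∉ Q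
  | query x next, Q => x ∉ Q ∧ ∀ a : L, (next a).Legal (insert x Q)

/-- The pair of candidates that is declared when the queries are answered according to `ℓ`. -/
def candidates {V L : Type*} : Adversary V L → (V → L) → V × V
  | declare x y, _ => (x, y)
  | query x next, ℓ => (next (ℓ x)).candidates ℓ

end Adversary

namespace LabelingScheme

/-- The decoder is wrong about the adjacency of `x` and `y` in `G` under the labeling `ℓ`: either
`x, y` are adjacent and rejected, or they are not adjacent and accepted. -/
def Errs {V : Type*} {s : ℕ} (S : LabelingScheme V s) (G : SimpleGraph V)
    (ℓ : V → (Fin s → Bool)) (x y : V) : Prop :=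
  ¬ (S.decoder (ℓ x) (ℓ y) = true ↔ G.Adj x y)

/-- The probability, over the labeling drawn by the encoder, that the adversary `A` forges: the
decoder is wrong about the pair of candidates that `A` declares. -/
noncomputable def winProb {V : Type*} {s : ℕ} (S : LabelingScheme V s) (G : SimpleGraph V)
    (A : Adversary V (Fin s → Bool)) : ℝ :=
  (S.encoder.toOuterMeasure
    {ℓ | S.Errs G ℓ (A.candidates ℓ).1 (A.candidates ℓ).2}).toReal

end LabelingScheme

/-! Each center `a` gets `d` private neighbours `y a k`, adjacent to no other center. For an index
`i < d` the adversary queries `y b k` for all centers `b` and all `k < i`, and calls two centers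
equivalent if these answers agree. It picks a random center `a` and declares, with probability one
half each, the edge `a`, `y a i` or the pair `a`, `y b i` with `b` a random center equivalent to
`a`. A decoder that errs much less than half the time must accept `y a i` noticeably more often than
the average `y b i` in its class.

This advantage cannot persist over all `i`. For one fixed label in place of the label of `a`, the
advantages form a bounded martingale difference sequence in `i`, so their sum has subgaussian
exponential moments (`sum_exp_deviation_le`). The actual label of `a` takes at most `2 ^ s` values,
and a union bound in exponential form costs only `s * log 2` (`sum_sum_deviation_le`). Hence the
mean advantage per index is small when `s` is small compared with `α ^ 2 * d`, and some `i` works.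
The draw `b = a` gives no non-edge, but it is rare because there are at most `2 ^ (s * i)` classes
and many centers. Finally, randomness in the choice of the pair can be removed by declaring the best
pair for the answers seen (`exists_legal_adversary`). -/

/-! ### Averages over cells and the random pair of centers -/

section CellAverage

open Finset

variable {ι κ : Type*} [Fintype ι] [DecidableEq κ]

/-- The average of `g` over the fibre of `W` through `a`. -/
noncomputable def cellAvg (W : ι → κ) (g : ι → ℝ) (a : ι) : ℝ :=
  (∑ b with W b = W a, g b) / (#{b | W b = W a} : ℝ)

theorem card_cell_pos (W : ι → κ) (a : ι) : (0 : ℝ) < (#{b | W b = W a} : ℝ) := by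
  exact_mod_cast card_pos.2 ⟨a, by simp⟩

theorem cellAvg_mem_Icc (W : ι → κ) {g : ι → ℝ} (h0 : ∀ a, 0 ≤ g a) (h1 : ∀ a, g a ≤ 1) (a : ι) :
    0 ≤ cellAvg W g a ∧ cellAvg W g a ≤ 1 := by
  refine ⟨div_nonneg (sum_nonneg fun b _ => h0 b) (card_cell_pos W a).le, ?_⟩
  rw [cellAvg, div_le_one (card_cell_pos W a)]
  calc ∑ b with W b = W a, g b ≤ ∑ b with W b = W a, (1 : ℝ) := sum_le_sum fun b _ => h1 b
    _ = _ := by simp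

theorem cellAvg_congr (W : ι → κ) (g : ι → ℝ) {a b : ι} (h : W a = W b) :
    cellAvg W g a = cellAvg W g b := by
  simp only [cellAvg, h]

/-- Averaging over the fibres of `W` is invisible to functions that are constant on the fibres. -/
theorem sum_mul_cellAvg (W : ι → κ) (h g : ι → ℝ) (hW : ∀ a b, W a = W b → h a = h b) :
    ∑ a, h a * cellAvg W g a = ∑ a, h a * g a := by
  have h1 : ∀ a, h a * cellAvg W g a =
      ∑ b, if W b = W a then h b * g b / (#{c | W c = W b} : ℝ) else 0 := by
    intro a
    rw [cellAvg, sum_div, mul_sum, ← sum_filter]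
    refine sum_congr rfl fun b hb => ?_
    have hb : W b = W a := by simpa using hb
    rw [hW a b hb.symm, hb, mul_div_assoc]
  simp_rw [h1]
  rw [sum_comm]
  refine sum_congr rfl fun b _ => ?_
  rw [← sum_filter, sum_const, nsmul_eq_mul]
  have : (univ.filter fun a => W b = W a) = univ.filter fun a => W a = W b := by
    ext a; simp [eq_comm]
  rw [this]
  have := (card_cell_pos W b).ne'
  field_simp

/-- Every nonempty cell contributes exactly `1`. This bounds the total loss from discarded pairs
`(a, a)`. -/
theorem sum_inv_card_cell_le [Fintype κ] (W : ι → κ) :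
    ∑ a, (1 : ℝ) / (#{b | W b = W a} : ℝ) ≤ Fintype.card κ := by
  calc ∑ a, (1 : ℝ) / (#{b | W b = W a} : ℝ)
      = ∑ k, ∑ a with W a = k, (1 : ℝ) / (#{b | W b = W a} : ℝ) :=
        (sum_fiberwise univ W _).symm
    _ ≤ ∑ _k : κ, (1 : ℝ) := by
        refine sum_le_sum fun k _ => ?_
        have : ∑ a with W a = k, (1 : ℝ) / (#{b | W b = W a} : ℝ)
            = ∑ a with W a = k, (1 : ℝ) / (#{b | W b = k} : ℝ) := by
          refine sum_congr rfl fun a ha => ?_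
          rw [(mem_filter.1 ha).2]
        rw [this, sum_const, nsmul_eq_mul, mul_one_div]
        exact div_self_le_one _
    _ = _ := by simp

/-- The weights of a random pair `(a, b)`: `a` is uniform, and `b` is `a` itself or a random member of
the fibre of `W` through `a`, with probability one half each; a pair `(a, a)` of the second kind is
discarded. -/
noncomputable def pairWeight [DecidableEq ι] (W : ι → κ) (p : ι × ι) : ℝ :=
  ((if p.2 = p.1 then 1 else 0) +
    (if W p.2 = W p.1 ∧ p.2 ≠ p.1 then 1 / (#{b | W b = W p.1} : ℝ) else 0)) /
      (2 * Fintype.card ι)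

theorem pairWeight_nonneg [DecidableEq ι] (W : ι → κ) (p : ι × ι) : 0 ≤ pairWeight W p := by
  unfold pairWeight
  refine div_nonneg (add_nonneg ?_ ?_) (by positivity) <;> split_ifs <;> positivity

theorem sum_pairWeight_le [DecidableEq ι] (W : ι → κ) : ∑ p, pairWeight W p ≤ 1 := by
  simp only [pairWeight]
  rw [← sum_div, Fintype.sum_prod_type]
  refine div_le_one_of_le₀ ?_ (by positivity)
  calc _ ≤ ∑ _a : ι, (2 : ℝ) := by
        refine sum_le_sum fun a _ => ?_
        rw [sum_add_distrib, sum_ite_eq' univ a, if_pos (mem_univ a)]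
        have : ∑ b, (if W b = W a ∧ b ≠ a then 1 / (#{b | W b = W a} : ℝ) else 0)
            ≤ ∑ b, if W b = W a then 1 / (#{b | W b = W a} : ℝ) else 0 := by
          refine sum_le_sum fun b _ => ?_
          split_ifs with h1 h2 h2
          · exact le_rfl
          · exact absurd h1.1 h2
          · positivity
          · exact le_rfl
        have hone : ∑ b, (if W b = W a then 1 / (#{b | W b = W a} : ℝ) else 0) = 1 := by
          rw [← sum_filter, sum_const, nsmul_eq_mul, mul_one_div,
            div_self (card_cell_pos W a).ne']
        linarith
    _ = _ := by simp [mul_comm]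

/-- Here `e` is the error indicator and `g` the acceptance indicator: an edge is wrong when
rejected, a non-edge when accepted, so the two halves leave only the gap between `g a a` and its
cell average. The discarded term `b = a` of that average is at most the inverse cell size. -/
theorem le_sum_pairWeight_mul [DecidableEq ι] (W : ι → κ) (e g : ι → ι → ℝ)
    (h1 : ∀ a b, g a b ≤ 1) (hdiag : ∀ a, e a a = 1 - g a a) (hoff : ∀ a b, b ≠ a → e a b = g a b) :
    (Fintype.card ι - ∑ a, (g a a - cellAvg W (g a) a)
        - ∑ a, 1 / (#{b | W b = W a} : ℝ)) / (2 * Fintype.card ι)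
      ≤ ∑ p : ι × ι, pairWeight W p * e p.1 p.2 := by
  simp only [pairWeight, div_mul_eq_mul_div]
  rw [← sum_div, Fintype.sum_prod_type]
  refine div_le_div_of_nonneg_right ?_ (by positivity)
  have hcard : (Fintype.card ι : ℝ) = ∑ _a : ι, (1 : ℝ) := by simp
  rw [hcard, ← sum_sub_distrib, ← sum_sub_distrib]
  refine sum_le_sum fun a _ => ?_
  simp only [add_mul, ite_mul, one_mul, zero_mul]
  rw [sum_add_distrib, sum_ite_eq' univ a, if_pos (mem_univ a), hdiag]
  have hpos := card_cell_pos W a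
  have : cellAvg W (g a) a - 1 / (#{b | W b = W a} : ℝ)
      ≤ ∑ b, if W b = W a ∧ b ≠ a then 1 / (#{b | W b = W a} : ℝ) * e a b else 0 := by
    have hself : 1 / (#{b | W b = W a} : ℝ)
        = ∑ b, if b = a then 1 / (#{b | W b = W a} : ℝ) else 0 := by
      rw [sum_ite_eq' univ a, if_pos (mem_univ a)]
    rw [cellAvg, sum_div, sum_filter]
    conv_lhs => rw [hself]
    rw [← sum_sub_distrib]
    refine sum_le_sum fun b _ => ?_
    by_cases hb : b = a
    · subst hb
      simp only [if_true, ne_eq, not_true_eq_false, and_false, if_false]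
      rw [sub_nonpos]
      exact div_le_div_of_nonneg_right (h1 b b) hpos.le
    · by_cases hW : W b = W a
      · simp only [hW, hb, if_true, if_false, ne_eq, not_false_eq_true, and_self, hoff a b hb]
        apply le_of_eq; ring
      · simp [hW, hb]
  linarith

end CellAverage

/-! ### Exponential moments of the deviations -/

section Martingale

open Finset

variable {ι L : Type*}

/-- The first `i` entries of the sequence attached to `a`. -/
def prefixWord (Y : ι → ℕ → L) (i : ℕ) (a : ι) : Fin i → L := fun k => Y a k

theorem prefixWord_eq_iff (Y : ι → ℕ → L) (i : ℕ) (a b : ι) :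
    prefixWord Y i a = prefixWord Y i b ↔ ∀ k < i, Y a k = Y b k :=
  ⟨fun h k hk => congrFun h ⟨k, hk⟩, fun h => funext fun k => h k k.2⟩

variable [Fintype ι] [DecidableEq L]

/-- The deviation of `g (Y a i)` from its average over those `b` whose first `i` entries agree with
those of `a`. -/
noncomputable def deviation (Y : ι → ℕ → L) (g : L → ℝ) (i : ℕ) (a : ι) : ℝ :=
  g (Y a i) - cellAvg (prefixWord Y i) (fun b => g (Y b i)) a

theorem abs_deviation_le (Y : ι → ℕ → L) {g : L → ℝ} (h0 : ∀ l, 0 ≤ g l) (h1 : ∀ l, g l ≤ 1)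
    (i : ℕ) (a : ι) : |deviation Y g i a| ≤ 1 := by
  have h := cellAvg_mem_Icc (prefixWord Y i) (g := fun b => g (Y b i)) (fun b => h0 _)
    (fun b => h1 _) a
  rw [deviation, abs_le]
  constructor <;> linarith [h0 (Y a i), h1 (Y a i), h.1, h.2]

/-- Predictability: earlier deviations are determined by the first `i` entries, since agreement on a
long prefix implies agreement on all shorter ones. -/
theorem sum_deviation_congr (Y : ι → ℕ → L) (g : L → ℝ) (i : ℕ) (a b : ι)
    (h : prefixWord Y i a = prefixWord Y i b) :
    ∑ k ∈ range i, deviation Y g k a = ∑ k ∈ range i, deviation Y g k b := by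
  rw [prefixWord_eq_iff] at h
  refine sum_congr rfl fun k hk => ?_
  have hk := mem_range.1 hk
  rw [deviation, deviation, h k hk, cellAvg_congr _ _
    ((prefixWord_eq_iff Y k a b).2 fun j hj => h j (hj.trans hk))]

/-- Azuma's inequality in exponential form, for the uniform measure on `ι`. -/
theorem sum_exp_deviation_le (Y : ι → ℕ → L) {g : L → ℝ} (h0 : ∀ l, 0 ≤ g l) (h1 : ∀ l, g l ≤ 1)
    {t : ℝ} (ht0 : 0 ≤ t) (ht1 : t ≤ 1) (d : ℕ) :
    ∑ a, Real.exp (t * ∑ k ∈ range d, deviation Y g k a)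
      ≤ Fintype.card ι * Real.exp (t ^ 2 * d) := by
  induction d with
  | zero => simp
  | succ i ih =>
    set E : ι → ℝ := fun a => Real.exp (t * ∑ k ∈ range i, deviation Y g k a) with hE
    -- `E` is constant on the cells of the length-`i` prefix, and the new deviation has mean zero on
    -- each of them.
    have hmean : ∑ a, E a * deviation Y g i a = 0 := by
      simp only [deviation, mul_sub, sum_sub_distrib]
      rw [sum_mul_cellAvg, sub_self]
      intro a b hab
      simp only [hE, sum_deviation_congr Y g i a b hab]
    have hstep : ∀ a, Real.exp (t * ∑ k ∈ range (i + 1), deviation Y g k a)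
        ≤ E a * (1 + t ^ 2) + t * (E a * deviation Y g i a) := by
      intro a
      have hd := abs_deviation_le Y h0 h1 i a
      have hz : |t * deviation Y g i a| ≤ 1 := by
        rw [abs_mul, abs_of_nonneg ht0]
        exact mul_le_one₀ ht1 (abs_nonneg _) hd
      have hexp := (abs_le.1 (Real.abs_exp_sub_one_sub_id_le hz)).2
      have hsq : (t * deviation Y g i a) ^ 2 ≤ t ^ 2 := by
        rw [mul_pow]
        exact mul_le_of_le_one_right (sq_nonneg t) ((sq_le_one_iff_abs_le_one _).2 hd)
      rw [sum_range_succ, mul_add, Real.exp_add]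
      calc E a * Real.exp (t * deviation Y g i a)
          ≤ E a * (1 + t ^ 2 + t * deviation Y g i a) :=
            mul_le_mul_of_nonneg_left (by linarith) (Real.exp_pos _).le
        _ = _ := by ring
    calc ∑ a, Real.exp (t * ∑ k ∈ range (i + 1), deviation Y g k a)
        ≤ ∑ a, (E a * (1 + t ^ 2) + t * (E a * deviation Y g i a)) := sum_le_sum fun a _ => hstep a
      _ = (∑ a, E a) * (1 + t ^ 2) := by
          rw [sum_add_distrib, ← mul_sum, hmean, mul_zero, add_zero, sum_mul]
      _ ≤ (Fintype.card ι * Real.exp (t ^ 2 * i)) * Real.exp (t ^ 2) := by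
          refine mul_le_mul ih ?_ (by positivity) (by positivity)
          linarith [Real.add_one_le_exp (t ^ 2)]
      _ = _ := by
          rw [mul_assoc, ← Real.exp_add]; push_cast; ring_nf

/-- If `X a` takes few values, then the total deviation of a test function that depends on `X a` is
small on average. -/
theorem sum_sum_deviation_le [Fintype L] [Nonempty L] (X : ι → L) (Y : ι → ℕ → L)
    {f : L → L → ℝ} (h0 : ∀ x l, 0 ≤ f x l) (h1 : ∀ x l, f x l ≤ 1)
    {t : ℝ} (ht0 : 0 ≤ t) (ht1 : t ≤ 1) (d : ℕ) :
    t * ∑ a, ∑ i ∈ range d, deviation Y (f (X a)) i a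
      ≤ Fintype.card ι * (Real.log (Fintype.card L) + t ^ 2 * d) := by
  set K : ℝ := Real.log (Fintype.card L) + t ^ 2 * d with hK
  have hL : (0 : ℝ) < Fintype.card L := by exact_mod_cast Fintype.card_pos
  have hexpK : Real.exp K = Fintype.card L * Real.exp (t ^ 2 * d) := by
    rw [hK, Real.exp_add, Real.exp_log hL]
  set M : L → ι → ℝ := fun x a => t * ∑ i ∈ range d, deviation Y (f x) i a with hM
  -- The tangent bound `z + 1 ≤ exp z` at `z = M - K`, with the one term `x = X a` enlarged to the
  -- sum over all labels. This removes the dependence of `X a` on `Y`; `K` is chosen so that the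
  -- last summand averages to at most `1`.
  have hlin : ∀ a, M (X a) a ≤ K - 1 + (∑ x, Real.exp (M x a)) * Real.exp (-K) := by
    intro a
    have h2 : Real.exp (M (X a) a) ≤ ∑ x, Real.exp (M x a) :=
      single_le_sum (f := fun x => Real.exp (M x a)) (fun x _ => (Real.exp_pos _).le)
        (mem_univ (X a))
    have h3 := Real.add_one_le_exp (M (X a) a - K)
    rw [sub_eq_add_neg, Real.exp_add] at h3
    have h4 := mul_le_mul_of_nonneg_right h2 (Real.exp_pos (-K)).le
    linarith
  have htot : ∑ a, ∑ x, Real.exp (M x a) ≤ Fintype.card ι * Real.exp K := by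
    rw [sum_comm, hexpK]
    calc ∑ x, ∑ a, Real.exp (M x a) ≤ ∑ _x : L, Fintype.card ι * Real.exp (t ^ 2 * d) :=
          sum_le_sum fun x _ => sum_exp_deviation_le Y (h0 x) (h1 x) ht0 ht1 d
      _ = _ := by rw [sum_const, card_univ, nsmul_eq_mul]; ring
  calc t * ∑ a, ∑ i ∈ range d, deviation Y (f (X a)) i a = ∑ a, M (X a) a := by
        rw [mul_sum]
    _ ≤ ∑ a, (K - 1 + (∑ x, Real.exp (M x a)) * Real.exp (-K)) := sum_le_sum fun a _ => hlin a
    _ = Fintype.card ι * (K - 1) + (∑ a, ∑ x, Real.exp (M x a)) * Real.exp (-K) := by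
        rw [sum_add_distrib, ← sum_mul, sum_const, card_univ, nsmul_eq_mul]
    _ ≤ Fintype.card ι * (K - 1) + (Fintype.card ι * Real.exp K) * Real.exp (-K) := by
        gcongr
    _ = _ := by
        rw [mul_assoc, ← Real.exp_add, add_neg_cancel, Real.exp_zero]; ring

end Martingale

/-! ### Non-adaptive queries and derandomization -/

namespace Adversary

variable {V L : Type*}

/-- Query the vertices of a list one after the other, then declare a pair that depends on the
answers. -/
def queryList : List V → (List L → V × V) → Adversary V L
  | [], f => declare (f []).1 (f []).2
  | v :: vs, f => query v fun a => queryList vs fun as => f (a :: as)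

theorem candidates_queryList (l : List V) (f : List L → V × V) (ℓ : V → L) :
    (queryList l f).candidates ℓ = f (l.map ℓ) := by
  induction l generalizing f with
  | nil => rfl
  | cons v vs ih => simp [queryList, candidates, ih]

theorem legal_queryList (l : List V) (f : List L → V × V) (Q : Set V) (hl : l.Nodup)
    (hQ : ∀ v ∈ l, v ∉ Q)
    (hf : ∀ as, (f as).1 ≠ (f as).2 ∧ (f as).1 ∉ Q ∧ (f as).2 ∉ Q ∧ (f as).1 ∉ l ∧ (f as).2 ∉ l) :
    (queryList l f).Legal Q := by
  induction l generalizing f Q with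
  | nil => exact ⟨(hf []).1, (hf []).2.1, (hf []).2.2.1⟩
  | cons v vs ih =>
    rw [List.nodup_cons] at hl
    refine ⟨hQ v (by simp), fun a => ih _ _ hl.2 ?_ ?_⟩
    · intro w hw hwQ
      rcases hwQ with rfl | hwQ
      · exact hl.1 hw
      · exact hQ w (by simp [hw]) hwQ
    · intro as
      have h := hf (a :: as)
      simp only [List.mem_cons, not_or] at h
      simp only [Set.mem_insert_iff, not_or]
      tauto

end Adversary

namespace LabelingScheme

open Finset

open scoped Classical in
theorem winProb_eq_sum {V : Type*} [Fintype V] {s : ℕ} (S : LabelingScheme V s) (G : SimpleGraph V)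
    (A : Adversary V (Fin s → Bool)) :
    S.winProb G A = ∑ ℓ, (S.encoder ℓ).toReal *
      if S.Errs G ℓ (A.candidates ℓ).1 (A.candidates ℓ).2 then 1 else 0 := by
  rw [winProb, PMF.toOuterMeasure_apply, tsum_fintype, ENNReal.toReal_sum]
  · refine sum_congr rfl fun ℓ _ => ?_
    simp only [Set.indicator_apply, Set.mem_ofPred_eq]
    split_ifs <;> simp
  · intro ℓ _
    simp only [Set.indicator_apply]
    split_ifs
    · exact S.encoder.apply_ne_top ℓ
    · simp

open scoped Classical in
theorem sum_encoder_toReal {V : Type*} [Fintype V] {s : ℕ} (S : LabelingScheme V s) :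
    ∑ ℓ : V → (Fin s → Bool), (S.encoder ℓ).toReal = 1 := by
  rw [← ENNReal.toReal_sum fun ℓ _ => S.encoder.apply_ne_top ℓ, ← tsum_fintype (L := .unconditional _),
    S.encoder.tsum_coe, ENNReal.toReal_one]

open scoped Classical in
/-- An adversary that queries a list of vertices and then declares a best pair does at least as well
as any randomized choice of the pair whose weights depend on the answers only. -/
theorem exists_legal_adversary {V : Type*} [Fintype V] {s : ℕ} (S : LabelingScheme V s)
    (G : SimpleGraph V) {J : Type*} [Fintype J] [Nonempty J] (l : List V) (hl : l.Nodup)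
    (pair : J → V × V)
    (hpair : ∀ j, (pair j).1 ≠ (pair j).2 ∧ (pair j).1 ∉ l ∧ (pair j).2 ∉ l)
    (q : (V → (Fin s → Bool)) → J → ℝ) (hq0 : ∀ ℓ j, 0 ≤ q ℓ j) (hq1 : ∀ ℓ, ∑ j, q ℓ j ≤ 1)
    (hq : ∀ ℓ ℓ' : V → (Fin s → Bool), l.map ℓ = l.map ℓ' → q ℓ = q ℓ') :
    ∃ A : Adversary V (Fin s → Bool), A.Legal ∅ ∧
      ∑ ℓ, (S.encoder ℓ).toReal *
        ∑ j, q ℓ j * (if S.Errs G ℓ (pair j).1 (pair j).2 then 1 else 0) ≤ S.winProb G A := by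
  set score : List (Fin s → Bool) → J → ℝ := fun as j =>
    ∑ ℓ with l.map ℓ = as, (S.encoder ℓ).toReal *
      (if S.Errs G ℓ (pair j).1 (pair j).2 then 1 else 0) with hscore
  have hmax : ∀ as, ∃ j, ∀ j', score as j' ≤ score as j := fun as =>
    Finite.exists_max (score as)
  choose best hbest using hmax
  have hscore0 : ∀ as j, 0 ≤ score as j := fun as j =>
    sum_nonneg fun ℓ _ => mul_nonneg ENNReal.toReal_nonneg (by split_ifs <;> simp)
  refine ⟨Adversary.queryList l fun as => pair (best as),
    Adversary.legal_queryList _ _ _ hl (by simp) fun as => ?_, ?_⟩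
  · have h := hpair (best as)
    simpa using h
  rw [winProb_eq_sum]
  simp only [Adversary.candidates_queryList]
  have hmaps : ∀ ℓ ∈ (univ : Finset (V → (Fin s → Bool))),
      l.map ℓ ∈ (univ : Finset (V → (Fin s → Bool))).image (fun ℓ => l.map ℓ) :=
    fun ℓ h => mem_image_of_mem _ h
  -- Among labelings with the same answers the weights `q` are fixed, so the best score dominates
  -- their weighted sum; total weight below `1` is harmless because scores are nonnegative.
  rw [← sum_fiberwise_of_maps_to hmaps, ← sum_fiberwise_of_maps_to hmaps]
  refine sum_le_sum fun as has => ?_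
  obtain ⟨ℓ₀, -, rfl⟩ := mem_image.1 has
  calc _ = ∑ j, q ℓ₀ j * score (l.map ℓ₀) j := by
        simp only [hscore, mul_sum]
        rw [sum_comm]
        refine sum_congr rfl fun j _ => sum_congr rfl fun ℓ hℓ => ?_
        rw [hq ℓ ℓ₀ (mem_filter.1 hℓ).2]
        ring
    _ ≤ ∑ j, q ℓ₀ j * score (l.map ℓ₀) (best (l.map ℓ₀)) :=
        sum_le_sum fun j _ => mul_le_mul_of_nonneg_left (hbest _ j) (hq0 _ _)
    _ ≤ 1 * score (l.map ℓ₀) (best (l.map ℓ₀)) := by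
        rw [← sum_mul]
        exact mul_le_mul_of_nonneg_right (hq1 _) (hscore0 _ _)
    _ = _ := by
        rw [one_mul]
        refine sum_congr rfl fun ℓ hℓ => ?_
        rw [(mem_filter.1 hℓ).2]

end LabelingScheme

/-! ### Private neighbours from the distance condition -/

namespace SimpleGraph

variable {V : Type*}

/-- Private neighbours of pairwise distant vertices. -/
theorem exists_private_neighbors [Fintype V] (G : SimpleGraph V) [DecidableRel G.Adj] (C : Finset V)
    (d : ℕ) (hdeg : ∀ x ∈ C, d ≤ G.degree x)
    (hdist : ∀ x ∈ C, ∀ y ∈ C, x ≠ y → 3 ≤ G.edist x y) :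
    ∃ y : C → ℕ → V, ∀ a b : C, ∀ k < d,
      (G.Adj a (y b k) ↔ b = a) ∧ y b k ≠ a ∧ ∀ m < d, y a m = y b k → m = k := by
  have hex : ∀ a : C, ∃ f : ℕ → V, ∀ k < d, G.Adj a (f k) ∧ ∀ m < d, f m = f k → m = k := by
    intro a
    have hcard : Fintype.card (Fin d) ≤ Fintype.card (G.neighborFinset a) := by
      rw [Fintype.card_fin, Fintype.card_coe]
      exact hdeg a a.2
    obtain ⟨f⟩ := Function.Embedding.nonempty_of_card_le hcard
    -- Indices from `d` on receive the junk value `a`; the conclusion concerns only indices below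
    -- `d`.
    refine ⟨fun k => if h : k < d then f ⟨k, h⟩ else a, fun k hk => ⟨?_, fun m hm h => ?_⟩⟩
    · simp only [dif_pos hk]
      exact (G.mem_neighborFinset _ _).1 (f ⟨k, hk⟩).2
    · simp only [dif_pos hk, dif_pos hm] at h
      simpa using f.injective (Subtype.ext h)
  choose y hy using hex
  have hadj : ∀ a b : C, ∀ k < d, G.Adj a (y b k) → b = a := by
    intro a b k hk h
    by_contra hne
    have h3 := hdist a a.2 b b.2 fun hab => hne (Subtype.ext hab.symm)
    have h2 : G.edist a b ≤ 2 :=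
      ((Walk.cons h (Walk.cons ((hy b k hk).1.symm) Walk.nil)).edist_le).trans (by simp)
    exact absurd (h3.trans h2) (by decide)
  refine ⟨y, fun a b k hk => ⟨⟨hadj a b k hk, ?_⟩, ?_, ?_⟩⟩
  · rintro rfl
    exact (hy b k hk).1
  · intro h
    have hab := (hy b k hk).1
    rw [h] at hab
    have h3 := hdist b b.2 a a.2 hab.ne
    have h2 : G.edist b a ≤ 1 := ((Walk.cons hab Walk.nil).edist_le).trans (by simp)
    exact absurd (h3.trans h2) (by decide)
  · intro m hm h
    have hab : b = a := hadj a b k hk (h ▸ (hy a m hm).1)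
    subst hab
    exact (hy b k hk).2 m hm h

end SimpleGraph

/-! ### The adversaries for each index and the choice of the index -/

namespace LabelingScheme

open Finset

variable {V : Type*} {s : ℕ}

/-- The decoder as a `0`-`1`-valued real function. -/
def decision (S : LabelingScheme V s) (x l : Fin s → Bool) : ℝ := if S.decoder x l then 1 else 0

theorem decision_nonneg (S : LabelingScheme V s) (x l : Fin s → Bool) : 0 ≤ S.decision x l := by
  unfold decision; split_ifs <;> simp

theorem decision_le_one (S : LabelingScheme V s) (x l : Fin s → Bool) : S.decision x l ≤ 1 := by
  unfold decision; split_ifs <;> simp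

open scoped Classical in
/-- For every `i < d` there is an adversary that loses against `1 / 2` at most the average deviation
and a term that vanishes as the number of centers grows. -/
theorem exists_adversary_deviation [Fintype V] (S : LabelingScheme V s) (G : SimpleGraph V)
    (C : Finset V) (hC : C.Nonempty) {d : ℕ} (y : C → ℕ → V)
    (hy : ∀ a b : C, ∀ k < d,
      (G.Adj a (y b k) ↔ b = a) ∧ y b k ≠ a ∧ ∀ m < d, y a m = y b k → m = k)
    {i : ℕ} (hi : i < d) :
    ∃ A : Adversary V (Fin s → Bool), A.Legal ∅ ∧
      ∑ ℓ, (S.encoder ℓ).toReal *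
        ((#C - ∑ a : C, deviation (fun b k => ℓ (y b k)) (S.decision (ℓ a)) i a
          - (2 : ℝ) ^ (s * i)) / (2 * #C)) ≤ S.winProb G A := by
  have : Nonempty C := hC.to_subtype
  set l : List V := (univ.image fun p : C × Fin i => y p.1 p.2).toList with hl
  set W : (V → (Fin s → Bool)) → C → (Fin i → (Fin s → Bool)) := fun ℓ =>
    prefixWord (fun b k => ℓ (y b k)) i with hW
  have hmem : ∀ v, v ∈ l ↔ ∃ b : C, ∃ k : Fin i, y b k = v := by
    intro v; simp only [hl, mem_toList, mem_image, mem_univ, true_and, Prod.exists]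
  have hpair : ∀ p : C × C, (p.1 : V) ≠ y p.2 i ∧ (p.1 : V) ∉ l ∧ y p.2 i ∉ l := by
    rintro ⟨a, b⟩
    refine ⟨((hy a b i hi).2.1).symm, fun h => ?_, fun h => ?_⟩
    · obtain ⟨c, k, hk⟩ := (hmem _).1 h
      exact (hy a c k (k.2.trans hi)).2.1 hk
    · obtain ⟨c, k, hk⟩ := (hmem _).1 h
      exact k.2.ne ((hy c b i hi).2.2 k (k.2.trans hi) hk)
  have hq : ∀ ℓ ℓ' : V → (Fin s → Bool), l.map ℓ = l.map ℓ' →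
      pairWeight (W ℓ) = pairWeight (W ℓ') := by
    intro ℓ ℓ' h
    have hWW : W ℓ = W ℓ' := by
      funext a k
      exact List.map_inj_left.1 h _ ((hmem _).2 ⟨a, k, rfl⟩)
    rw [hWW]
  obtain ⟨A, hA, hwin⟩ := S.exists_legal_adversary G l (nodup_toList _)
    (fun p : C × C => ((p.1 : V), y p.2 i)) hpair (fun ℓ => pairWeight (W ℓ))
    (fun ℓ => pairWeight_nonneg _) (fun ℓ => sum_pairWeight_le _) hq
  refine ⟨A, hA, le_trans (sum_le_sum fun ℓ _ => ?_) hwin⟩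
  refine mul_le_mul_of_nonneg_left ?_ ENNReal.toReal_nonneg
  have key := le_sum_pairWeight_mul (W ℓ)
    (fun a b => if S.Errs G ℓ a (y b i) then 1 else 0)
    (fun a b => S.decision (ℓ a) (ℓ (y b i))) (fun a b => S.decision_le_one _ _) ?_ ?_
  · refine le_trans ?_ key
    rw [Fintype.card_coe]
    refine div_le_div_of_nonneg_right ?_ (by positivity)
    have hcells := sum_inv_card_cell_le (W ℓ)
    have hcard : ((Fintype.card (Fin i → (Fin s → Bool)) : ℕ) : ℝ) = 2 ^ (s * i) := by
      simp [pow_mul]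
    rw [hcard] at hcells
    exact sub_le_sub_left hcells _
  · intro a
    have := (hy a a i hi).1.2 rfl
    simp only [Errs, this, iff_true, decision]
    split_ifs <;> simp
  · intro a b hab
    have : ¬ G.Adj a (y b i) := fun h => hab ((hy a b i hi).1.1 h)
    simp only [Errs, this, iff_false, not_not, decision]

end LabelingScheme

-- Averaging over `i < d`: the deviations and the discarded pairs each cost at most `α / 2` on
-- average, so some index loses at most `α`.
open Finset in
open scoped Classical in
theorem LabelingScheme.exists_adversary_of_card_le {V : Type*} [Fintype V] {s : ℕ}
    (S : LabelingScheme V s) (G : SimpleGraph V) (C : Finset V) (hC : C.Nonempty) {d : ℕ}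
    (hd : 0 < d) (y : C → ℕ → V)
    (hy : ∀ a b : C, ∀ k < d,
      (G.Adj a (y b k) ↔ b = a) ∧ y b k ≠ a ∧ ∀ m < d, y a m = y b k → m = k)
    {α : ℝ} (h0 : 0 < α) (h1 : α ≤ 1) (hs : 4 * (s : ℝ) ≤ α ^ 2 * d)
    (hn : (2 : ℝ) ^ (s * d) ≤ α * #C) :
    ∃ A : Adversary V (Fin s → Bool), A.Legal ∅ ∧ 1 / 2 - α ≤ S.winProb G A := by
  -- An illegal strategy, serving only as the default value for `i ≥ d`.
  have : Nonempty (Adversary V (Fin s → Bool)) := hC.elim fun v _ => ⟨.declare v v⟩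
  choose! A hA hwin using fun i (hi : i < d) => S.exists_adversary_deviation G C hC y hy hi
  have hCpos : (0 : ℝ) < #C := by exact_mod_cast hC.card_pos
  have hdev : ∀ ℓ : V → (Fin s → Bool),
      ∑ a : C, ∑ i ∈ range d, deviation (fun b k => ℓ (y b k)) (S.decision (ℓ a)) i a
        ≤ #C * (α * d) := by
    intro ℓ
    -- With `t = α / 2` the bound `s + t ^ 2 * d` is at most `α ^ 2 * d / 2 = t * (α * d)`, by `hs`.
    have h := sum_sum_deviation_le (fun a : C => ℓ a) (fun b k => ℓ (y b k))
      S.decision_nonneg S.decision_le_one (t := α / 2) (by positivity) (by linarith) d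
    have hlog : Real.log (Fintype.card (Fin s → Bool)) ≤ s := by
      have : Real.log 2 ≤ 1 := Real.log_two_lt_d9.le.trans (by norm_num)
      simp only [Fintype.card_fun, Fintype.card_bool, Fintype.card_fin, Nat.cast_pow,
        Nat.cast_ofNat, Real.log_pow]
      exact mul_le_of_le_one_right (by positivity) this
    rw [Fintype.card_coe] at h
    refine le_of_mul_le_mul_left (h.trans ?_) (half_pos h0)
    calc (#C : ℝ) * (Real.log (Fintype.card (Fin s → Bool)) + (α / 2) ^ 2 * d)
        ≤ #C * (α / 2 * (α * d)) := by
          refine mul_le_mul_of_nonneg_left ?_ hCpos.le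
          linarith
      _ = _ := by ring
  have hgoal : ∃ i ∈ range d, 1 / 2 - α ≤ S.winProb G (A i) := by
    refine exists_le_of_sum_le (nonempty_range_iff.2 hd.ne') ?_
    calc ∑ i ∈ range d, (1 / 2 - α)
        = ∑ ℓ, (S.encoder ℓ).toReal * (d * (1 / 2 - α)) := by
          rw [← sum_mul, S.sum_encoder_toReal, sum_const, card_range, nsmul_eq_mul, one_mul]
      _ ≤ ∑ ℓ, (S.encoder ℓ).toReal * ∑ i ∈ range d,
            ((#C - ∑ a : C, deviation (fun b k => ℓ (y b k)) (S.decision (ℓ a)) i a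
              - (2 : ℝ) ^ (s * i)) / (2 * #C)) := by
          refine sum_le_sum fun ℓ _ => mul_le_mul_of_nonneg_left ?_ ENNReal.toReal_nonneg
          have hpow : ∑ i ∈ range d, (2 : ℝ) ^ (s * i) ≤ d * (α * #C) := by
            calc ∑ i ∈ range d, (2 : ℝ) ^ (s * i) ≤ ∑ _i ∈ range d, α * #C := by
                  refine sum_le_sum fun i hi => le_trans ?_ hn
                  exact pow_le_pow_right₀ one_le_two
                    (Nat.mul_le_mul_left s (mem_range.1 hi).le)
              _ = _ := by simp
          have hdev' := hdev ℓ
          rw [sum_comm] at hdev'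
          rw [← sum_div, le_div_iff₀ (by positivity), sum_sub_distrib, sum_sub_distrib, sum_const,
            card_range, nsmul_eq_mul]
          linarith
      _ = ∑ i ∈ range d, ∑ ℓ, (S.encoder ℓ).toReal *
            ((#C - ∑ a : C, deviation (fun b k => ℓ (y b k)) (S.decision (ℓ a)) i a
              - (2 : ℝ) ^ (s * i)) / (2 * #C)) := by
          simp only [mul_sum]
          exact sum_comm
      _ ≤ _ := sum_le_sum fun i hi => hwin i (mem_range.1 hi)
  obtain ⟨i, hi, h⟩ := hgoal
  exact ⟨A i, hA i (mem_range.1 hi), h⟩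

theorem mainTheorem8 :
    ∃ c : ℝ, 0 < c ∧
      ∀ α : ℝ, 0 < α → α < 1 / 2 →
        ∀ d : ℕ, ∃ n : ℕ, 0 < n ∧
          ∀ (V : Type*) [Fintype V] (G : SimpleGraph V) [DecidableRel G.Adj] (C : Finset V),
            n ≤ C.card →
            (∀ x ∈ C, d ≤ G.degree x) →
            (∀ x ∈ C, ∀ y ∈ C, x ≠ y → 3 ≤ G.edist x y) →
            ∀ (s : ℕ) (S : LabelingScheme V s),
              (s : ℝ) < c * α ^ 4 * (d : ℝ) →
              ∃ A : Adversary V (Fin s → Bool),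
                A.Legal ∅ ∧ 1 / 2 - α ≤ S.winProb G A := by
  -- The number of centers must not depend on `s`; the label bound forces `s ≤ d`, so `2 ^ (d * d)`
  -- dominates `2 ^ (s * d)`.
  refine ⟨1, one_pos, fun α h0 h1 d => ⟨⌈(2 : ℝ) ^ (d * d) / α⌉₊, by positivity, ?_⟩⟩
  intro V _ G _ C hn hdeg hdist s S hs
  rw [one_mul] at hs
  have hd : 0 < d := by
    rcases Nat.eq_zero_or_pos d with rfl | h
    · simp only [Nat.cast_zero, mul_zero] at hs
      exact absurd hs (not_lt.2 s.cast_nonneg)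
    · exact h
  -- The argument only needs `4 * s ≤ α ^ 2 * d`. Since `α < 1 / 2`, the stronger hypothesis with `α
  -- ^ 4` yields this with `c = 1`.
  have hsq : 4 * α ^ 2 ≤ 1 := by nlinarith
  have hs4 : 4 * (s : ℝ) ≤ α ^ 2 * d := by
    have : 4 * α ^ 4 * d ≤ α ^ 2 * d := by
      refine mul_le_mul_of_nonneg_right ?_ d.cast_nonneg
      calc 4 * α ^ 4 = (4 * α ^ 2) * α ^ 2 := by ring
        _ ≤ 1 * α ^ 2 := mul_le_mul_of_nonneg_right hsq (sq_nonneg α)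
        _ = _ := one_mul _
    linarith
  have hsd : s ≤ d := by
    have : α ^ 2 * d ≤ 1 * d := mul_le_mul_of_nonneg_right (by linarith [sq_nonneg α]) d.cast_nonneg
    have hs0 : (0 : ℝ) ≤ s := s.cast_nonneg
    exact_mod_cast (by linarith : (s : ℝ) ≤ d)
  have hbig : (2 : ℝ) ^ (d * d) / α ≤ C.card := (Nat.le_ceil _).trans (by exact_mod_cast hn)
  have hC : C.Nonempty := by
    rw [← Finset.card_pos]
    exact_mod_cast (show (0 : ℝ) < (2 : ℝ) ^ (d * d) / α by positivity).trans_le hbig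
  obtain ⟨y, hy⟩ := G.exists_private_neighbors C d hdeg hdist
  refine S.exists_adversary_of_card_le G C hC hd y hy h0 (by linarith) hs4 ?_
  rw [div_le_iff₀ h0, mul_comm (C.card : ℝ)] at hbig
  exact (pow_le_pow_right₀ one_le_two (Nat.mul_le_mul_right d hsd)).trans hbig
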